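/- Let $\mathcal X,\mathcal S,\mathcal Y,\mathcal Z$ be finite sets, let $P_S$ be a probability mass function on $\mathcal S$, and let $W(y,z|x,s)$ be a conditional probability mass function on $\mathcal Y\times\mathcal Z$ given $(x,s)\in\mathcal X\times\mathcal S$. Consider the memoryless state-dependent broadcast channel without feedback with transition law $W$, whose state sequence $S^n$ is IID according to $P_S$. A code of block-length $n$ with message sets of sizes $m_y,m_z$ consists of an encoder $(i,j,s^n)\mapsto x^n$, a decoder $(y^n,s^n)\mapsto \hat\imath$ for the $Y$-receiver, and a decoder $z^n\mapsto\hat\jmath$ for the $Z$-receiver; that is, the whole state sequence is known noncausally to the transmitter and is also known to the $Y$-receiver. Its error probability is the probability that $\hat\imath\neq i$ or $\hat\jmath\neq j$ when the messages $i,j$ are independent and uniformly distributed. A pair $(R_y,R_z)$ of nonnegative reals is achievable if for every $\epsilon>0$ there is, for all sufficiently large $n$, a code of block-length $n$ with $m_y=\lfloor 2^{nR_y}\rfloor$, $m_z=\lfloor 2^{nR_z}\rfloor$ and error probability less than $\epsilon$. The capacity region is the closure of the set of achievable pairs. Proposition. The capacity region is contained in the closure of the convex hull of the set of all pairs $(R_y,R_z)\in\mathbb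 R^2$ for which there are a finite set $\mathcal U$ and a conditional probability mass function $P_{XU|S}(x,u|s)$ on $\mathcal X\times\mathcal U$ given $s \in \mathcal S$ such that $$R_y < I(X;Y|S),$$ $$R_z < I(U;Z)-I(U;S),$$ $$R_y+R_z < I(X;Y|S)+I(U;Z)-I(U;S,Y),$$ where the information measures (in bits) are computed under the joint law $$P_{XYZSU}(x,y,z,s,u)=P_S(s)\,P_{XU|S}(x,u|s)\,W(y,z|x,s).$$ -/

import Mathlib

noncomputable section

namespace BroadcastChannel

/-! ### Shannon information measures, in bits, of random variables on a finite probability space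

`P : Ω → ℝ` is a probability mass function on the finite set `Ω`, and random variables are
functions on `Ω`. -/

section Information

variable {Ω A B C : Type*} [Fintype Ω] [Fintype A] [Fintype B] [Fintype C]

open Classical in
/-- The probability mass function of the random variable `f` under `P`. -/
def law (P : Ω → ℝ) (f : Ω → A) (a : A) : ℝ :=
  ∑ ω with f ω = a, P ω

/-- Shannon entropy `H(f)` in bits; `Real.negMulLog t = -t * log t` with `0 * log 0 = 0`. -/
def entropy (P : Ω → ℝ) (f : Ω → A) : ℝ :=
  (∑ a, Real.negMulLog (law P f a)) / Real.log 2

/-- Conditional entropy `H(f | g) = H(f, g) - H(g)`. -/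
def condEntropy (P : Ω → ℝ) (f : Ω → A) (g : Ω → B) : ℝ :=
  entropy P (fun ω => (f ω, g ω)) - entropy P g

/-- Mutual information `I(f; g) = H(f) - H(f | g)`. -/
def mutualInfo (P : Ω → ℝ) (f : Ω → A) (g : Ω → B) : ℝ :=
  entropy P f - condEntropy P f g

/-- Conditional mutual information `I(f; g | h) = H(f | h) - H(f | g, h)`. -/
def condMutualInfo (P : Ω → ℝ) (f : Ω → A) (g : Ω → B) (h : Ω → C) : ℝ :=
  condEntropy P f h - condEntropy P f (fun ω => (g ω, h ω))

end Information

/-- A discrete memoryless state-dependent broadcast channel with input alphabet `X`, state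
alphabet `S` and output alphabets `Y` and `Z`: a state law `P_S(s)` and a transition law
`W(y, z | x, s)`, here `trans x s (y, z)`. -/
structure Channel (X S Y Z : Type*) [Fintype S] [Fintype Y] [Fintype Z] where
  stateLaw : S → ℝ
  stateLaw_mem : stateLaw ∈ stdSimplex ℝ S
  trans : X → S → Y × Z → ℝ
  trans_mem : ∀ x s, trans x s ∈ stdSimplex ℝ (Y × Z)

/-- A code of block-length `n` with `my` messages for the `Y`-receiver and `mz` messages for the
`Z`-receiver. The encoder sees the whole state sequence before transmission (noncausal
state-information), and so does the decoder of the `Y`-receiver; the decoder of the `Z`-receiver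
sees only its channel output. -/
structure Code (X S Y Z : Type*) (n my mz : ℕ) where
  enc : Fin my → Fin mz → (Fin n → S) → (Fin n → X)
  decY : (Fin n → Y) → (Fin n → S) → Fin my
  decZ : (Fin n → Z) → Fin mz

section Capacity

variable {X S Y Z : Type*} [Fintype S] [Fintype Y] [Fintype Z]

/-- The probability that at least one of the two receivers decodes its message incorrectly, when
the two messages are independent and uniform, the states are IID, and the channel is memoryless
and used without feedback. -/
def errorProb (ch : Channel X S Y Z) {n my mz : ℕ} (c : Code X S Y Z n my mz) : ℝ :=
  (∑ i : Fin my, ∑ j : Fin mz, ∑ s : Fin n → S, ∑ y : Fin n → Y, ∑ z : Fin n → Z,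
    (∏ t, ch.stateLaw (s t)) * (∏ t, ch.trans (c.enc i j s t) (s t) (y t, z t)) *
      (if c.decY y s = i ∧ c.decZ z = j then 0 else 1)) / ((my : ℝ) * (mz : ℝ))

/-- The rate-pair `R = (R_y, R_z)`, in bits per channel use, is achievable: for every `ε > 0` and
all sufficiently large block-lengths `n` there is a code with `⌊2 ^ (n R_y)⌋` and `⌊2 ^ (n R_z)⌋`
messages whose error probability is less than `ε`. -/
def Achievable (ch : Channel X S Y Z) (R : ℝ × ℝ) : Prop :=
  0 ≤ R.1 ∧ 0 ≤ R.2 ∧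
    ∀ ε : ℝ, 0 < ε → ∀ᶠ n : ℕ in Filter.atTop,
      ∃ c : Code X S Y Z n ⌊(2 : ℝ) ^ ((n : ℝ) * R.1)⌋₊ ⌊(2 : ℝ) ^ ((n : ℝ) * R.2)⌋₊,
        errorProb ch c < ε

/-- The capacity region: the closure of the set of achievable rate-pairs. -/
def capacityRegion (ch : Channel X S Y Z) : Set (ℝ × ℝ) :=
  closure {R | Achievable ch R}

end Capacity

section OuterBound

variable {X S Y Z U : Type*} [Fintype X] [Fintype S] [Fintype Y] [Fintype Z] [Fintype U]

/-- The joint law `P_S(s) P_{XU|S}(x, u | s) W(y, z | x, s)` of `(X, Y, Z, S, U)`, where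
`P_{XU|S}(x, u | s)` is `q s (x, u)`. -/
def jointLaw (ch : Channel X S Y Z) (q : S → X × U → ℝ) : X × Y × Z × S × U → ℝ :=
  fun (x, y, z, s, u) => ch.stateLaw s * q s (x, u) * ch.trans x s (y, z)

/-- The pairs `(R_y, R_z)` with `R_y < I(X;Y|S)`, `R_z < I(U;Z) - I(U;S)` and
`R_y + R_z < I(X;Y|S) + I(U;Z) - I(U;S,Y)` under the joint law `P` of `(X, Y, Z, S, U)`. -/
def rateRegion (P : X × Y × Z × S × U → ℝ) : Set (ℝ × ℝ) :=
  let rvX : X × Y × Z × S × U → X := fun (x, _, _, _, _) => x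
  let rvY : X × Y × Z × S × U → Y := fun (_, y, _, _, _) => y
  let rvZ : X × Y × Z × S × U → Z := fun (_, _, z, _, _) => z
  let rvS : X × Y × Z × S × U → S := fun (_, _, _, s, _) => s
  let rvU : X × Y × Z × S × U → U := fun (_, _, _, _, u) => u
  {R | R.1 < condMutualInfo P rvX rvY rvS ∧
    R.2 < mutualInfo P rvU rvZ - mutualInfo P rvU rvS ∧
    R.1 + R.2 < condMutualInfo P rvX rvY rvS + mutualInfo P rvU rvZ -
      mutualInfo P rvU (fun ω => (rvS ω, rvY ω))}

end OuterBound

/-- The union of the rate regions over all finite alphabets of the auxiliary random variable `U`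
(up to relabelling, `Fin k`) and all conditional laws `P_{XU|S}`. -/
def outerRegion {X S Y Z : Type*} [Fintype X] [Fintype S] [Fintype Y] [Fintype Z]
    (ch : Channel X S Y Z) : Set (ℝ × ℝ) :=
  {R | ∃ (k : ℕ) (q : S → X × Fin k → ℝ),
    (∀ s, q s ∈ stdSimplex ℝ (X × Fin k)) ∧ R ∈ rateRegion (jointLaw ch q)}

end BroadcastChannel

end

noncomputable section

namespace BroadcastChannel

/-! ### Entropy inequalities, all derived from Gibbs' inequality. -/

section Entropy

variable {Ω A B C : Type*} [Fintype Ω]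

/-! Write M₁, M₂ for the messages and τ_t = (S_t, Y_t). Given a code, consider two auxiliaries at
time t: u_t = (M₂, Z^{t-1}, τ_{t+1}^n) and the coarser v_t = (M₂, Z^{t-1}, S_{t+1}^n). Fano's
inequality, the product form of the block law and Csiszár's sum identity (`sum_mutualInfo_auxVar`,
used once with τ and once with S) give, up to Fano terms, nR_y ≤ Σ I(X_t;Y_t|S_t), nR_z ≤ Σ
[I(v_t;Z_t) - I(v_t;S_t)] and n(R_y+R_z) ≤ Σ [I(X_t;Y_t|S_t) + I(u_t;Z_t) - I(u_t;τ_t)].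

The last two bounds involve different auxiliaries, while the region asks for a single one. Put f(w)
= I(w;Z_t) - I(w;S_t) and g(w) = I(w;Z_t) - I(w;S_t,Y_t) = f(w) - I(w;Y_t|S_t). As u_t refines v_t,
I(u_t;Y_t|S_t) ≥ I(v_t;Y_t|S_t), so f(u_t) < f(v_t) forces g(u_t) ≤ g(v_t). Hence at each time u_t
or v_t alone meets both bounds (`mutualInfo_sub_le_or`).

Neither auxiliary depends on the outputs at time t, so each time yields points of the outer region
(`mem_outerRegion_of_law`). Averaging over time (`mem_of_average_lt`) puts the rate pair, less an
arbitrarily small loss, in the convex hull; the closure absorbs the loss. -/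

theorem sum_law_mul [Fintype A] (P : Ω → ℝ) (f : Ω → A) (φ : A → ℝ) :
    ∑ a, law P f a * φ a = ∑ ω, P ω * φ (f ω) := by
  classical
  simp only [law, Finset.sum_filter, Finset.sum_mul]
  rw [Finset.sum_comm]
  refine Finset.sum_congr rfl fun ω _ => ?_
  simp [ite_mul]

theorem law_comp [Fintype A] (P : Ω → ℝ) (f : Ω → A) (g : A → B) :
    law (law P f) g = law P (fun ω => g (f ω)) := by
  classical
  funext b
  have := sum_law_mul P f (fun a => if g a = b then 1 else 0)
  simpa [law, Finset.sum_filter] using this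

theorem law_congr (P : Ω → ℝ) {f : Ω → A} {g : Ω → B} {a : A} {b : B}
    (h : ∀ ω, f ω = a ↔ g ω = b) : law P f a = law P g b := by
  classical
  exact Finset.sum_congr (Finset.filter_congr fun ω _ => h ω) fun _ _ => rfl

theorem law_nonneg {P : Ω → ℝ} (hP : ∀ ω, 0 ≤ P ω) (f : Ω → A) (a : A) : 0 ≤ law P f a :=
  Finset.sum_nonneg fun ω _ => hP ω

theorem le_law {P : Ω → ℝ} (hP : ∀ ω, 0 ≤ P ω) (f : Ω → A) (ω : Ω) : P ω ≤ law P f (f ω) := by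
  classical
  exact Finset.single_le_sum (f := P) (fun ω _ => hP ω) (by simp)

theorem sum_law [Fintype A] (P : Ω → ℝ) (f : Ω → A) : ∑ a, law P f a = ∑ ω, P ω := by
  simpa using sum_law_mul P f (fun _ => 1)

theorem sum_law_pair [Fintype A] (P : Ω → ℝ) (f : Ω → A) (g : Ω → B) (b : B) :
    ∑ a, law P (fun ω => (f ω, g ω)) (a, b) = law P g b := by
  classical
  simp only [law, Finset.sum_filter, Prod.mk.injEq]
  rw [Finset.sum_comm]
  refine Finset.sum_congr rfl fun ω _ => ?_
  simp [ite_and]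

variable [Fintype A] [Fintype B] [Fintype C]

theorem entropy_eq_sum (P : Ω → ℝ) (f : Ω → A) :
    entropy P f = -∑ ω, P ω * Real.logb 2 (law P f (f ω)) := by
  rw [← sum_law_mul P f (fun a => Real.logb 2 (law P f a)), entropy, Finset.sum_div,
    ← Finset.sum_neg_distrib]
  refine Finset.sum_congr rfl fun a _ => ?_
  rw [Real.negMulLog, Real.logb]
  ring

/-- Entropy sees a random variable only through the partition of `Ω` into its fibres. This settles
every relabelling, permutation and deletion of redundant components below. -/
theorem entropy_congr (P : Ω → ℝ) {f : Ω → A} {g : Ω → B}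
    (h : ∀ ω ω', f ω = f ω' ↔ g ω = g ω') : entropy P f = entropy P g := by
  have hl : ∀ ω, law P f (f ω) = law P g (g ω) := fun ω => law_congr P fun ω' => h ω' ω
  simp only [entropy_eq_sum, hl]

theorem entropy_law (P : Ω → ℝ) (f : Ω → A) (g : A → B) :
    entropy (law P f) g = entropy P (fun ω => g (f ω)) := by
  simp only [entropy, law_comp]

/-- Gibbs' inequality: entropy is at most cross-entropy. -/
theorem entropy_le_crossEntropy {P : Ω → ℝ} (hP : P ∈ stdSimplex ℝ Ω) (f : Ω → A) (Q : A → ℝ)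
    (hQ : ∀ a, 0 ≤ Q a) (hQ1 : ∑ a, Q a ≤ 1) (hpos : ∀ ω, 0 < P ω → 0 < Q (f ω)) :
    entropy P f ≤ -∑ ω, P ω * Real.logb 2 (Q (f ω)) := by
  have hl2 : 0 < Real.log 2 := Real.log_pos (by norm_num)
  have key : ∀ ω, P ω * Real.logb 2 (Q (f ω)) - P ω * Real.logb 2 (law P f (f ω)) ≤
      P ω * ((Q (f ω) / law P f (f ω) - 1) / Real.log 2) := by
    intro ω
    rcases (hP.1 ω).eq_or_lt with h0 | h0
    · simp [← h0]
    have hl := h0.trans_le (le_law hP.1 f ω)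
    have hq := hpos ω h0
    rw [← mul_sub, ← Real.logb_div hq.ne' hl.ne']
    refine mul_le_mul_of_nonneg_left ?_ h0.le
    rw [Real.logb]
    exact div_le_div_of_nonneg_right (Real.log_le_sub_one_of_pos (div_pos hq hl)) hl2.le
  have hsum : ∑ ω, P ω * ((Q (f ω) / law P f (f ω) - 1) / Real.log 2) ≤ 0 := by
    rw [← sum_law_mul P f (fun a => (Q a / law P f a - 1) / Real.log 2)]
    have : ∀ a, law P f a * ((Q a / law P f a - 1) / Real.log 2) ≤
        (Q a - law P f a) / Real.log 2 := by
      intro a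
      rcases (law_nonneg hP.1 f a).eq_or_lt with h0 | h0
      · rw [← h0]; simpa using div_nonneg (hQ a) hl2.le
      · apply le_of_eq; field_simp
    refine (Finset.sum_le_sum fun a _ => this a).trans ?_
    rw [← Finset.sum_div, Finset.sum_sub_distrib, sum_law, hP.2]
    exact div_nonpos_of_nonpos_of_nonneg (by linarith) hl2.le
  have := (Finset.sum_le_sum fun ω (_ : ω ∈ Finset.univ) => key ω).trans hsum
  rw [Finset.sum_sub_distrib] at this
  rw [entropy_eq_sum]
  linarith

/-- The conditional form of Gibbs' inequality. -/
theorem condEntropy_le_crossEntropy {P : Ω → ℝ} (hP : P ∈ stdSimplex ℝ Ω) (f : Ω → A) (g : Ω → B)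
    (K : B → A → ℝ) (hK : ∀ b a, 0 ≤ K b a) (hK1 : ∀ b, ∑ a, K b a ≤ 1)
    (hpos : ∀ ω, 0 < P ω → 0 < K (g ω) (f ω)) :
    condEntropy P f g ≤ -∑ ω, P ω * Real.logb 2 (K (g ω) (f ω)) := by
  have h := entropy_le_crossEntropy hP (fun ω => (f ω, g ω))
    (fun p => law P g p.2 * K p.2 p.1) (fun p => mul_nonneg (law_nonneg hP.1 g _) (hK _ _))
    (by
      rw [Fintype.sum_prod_type_right]
      simp only [← Finset.mul_sum]
      calc ∑ b, law P g b * ∑ a, K b a ≤ ∑ b, law P g b * 1 :=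
            Finset.sum_le_sum fun b _ =>
              mul_le_mul_of_nonneg_left (hK1 b) (law_nonneg hP.1 g b)
        _ = 1 := by simp [sum_law, hP.2])
    (fun ω h => mul_pos (h.trans_le (le_law hP.1 g ω)) (hpos ω h))
  have h2 : ∑ ω, P ω * Real.logb 2 (law P g (g ω) * K (g ω) (f ω)) =
      ∑ ω, P ω * Real.logb 2 (law P g (g ω)) + ∑ ω, P ω * Real.logb 2 (K (g ω) (f ω)) := by
    rw [← Finset.sum_add_distrib]
    refine Finset.sum_congr rfl fun ω _ => ?_
    rcases (hP.1 ω).eq_or_lt with h0 | h0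
    · simp [← h0]
    · rw [Real.logb_mul (h0.trans_le (le_law hP.1 g ω)).ne' (hpos ω h0).ne', mul_add]
  rw [condEntropy, entropy_eq_sum P g]
  simp only at h
  linarith

/-- Conditioning on more reduces entropy. -/
theorem condEntropy_le_of_determines {P : Ω → ℝ} (hP : P ∈ stdSimplex ℝ Ω) (f : Ω → A) (g : Ω → B)
    (h : Ω → C) (hgh : ∀ ω ω', g ω = g ω' → h ω = h ω') :
    condEntropy P f g ≤ condEntropy P f h := by
  have hlaw : ∀ ω, law P (fun ω => (f ω, g ω, h ω)) (f ω, g ω, h ω) =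
      law P (fun ω => (f ω, g ω)) (f ω, g ω) := by
    refine fun ω => law_congr P fun ω' => ?_
    simp only [Prod.mk.injEq]
    exact ⟨fun H => ⟨H.1, H.2.1⟩, fun H => ⟨H.1, H.2, hgh _ _ H.2⟩⟩
  -- The competing kernel is the conditional law of `f` given `h` alone. Where the law of `h`
  -- vanishes, division by zero makes the row zero, which is why kernels need only have row sums at
  -- most one.
  have h1 := condEntropy_le_crossEntropy hP f (fun ω => (g ω, h ω))
    (fun p a => law P (fun ω => (f ω, h ω)) (a, p.2) / law P h p.2)
    (fun p a => div_nonneg (law_nonneg hP.1 _ _) (law_nonneg hP.1 _ _))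
    (fun p => by
      rw [← Finset.sum_div, sum_law_pair]
      exact div_self_le_one _)
    (fun ω h0 => div_pos (h0.trans_le (le_law hP.1 (fun ω => (f ω, h ω)) ω))
      (h0.trans_le (le_law hP.1 h ω)))
  have h2 : ∑ ω, P ω * Real.logb 2 (law P (fun ω => (f ω, h ω)) (f ω, h ω) / law P h (h ω)) =
      ∑ ω, P ω * Real.logb 2 (law P (fun ω => (f ω, h ω)) (f ω, h ω)) -
        ∑ ω, P ω * Real.logb 2 (law P h (h ω)) := by
    rw [← Finset.sum_sub_distrib]
    refine Finset.sum_congr rfl fun ω _ => ?_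
    rcases (hP.1 ω).eq_or_lt with h0 | h0
    · simp [← h0]
    · rw [Real.logb_div (h0.trans_le (le_law hP.1 (fun ω => (f ω, h ω)) ω)).ne'
        (h0.trans_le (le_law hP.1 h ω)).ne', mul_sub]
  have h3 : condEntropy P f (fun ω => (g ω, h ω)) = condEntropy P f g := by
    rw [condEntropy, condEntropy,
      entropy_congr P (f := fun ω => (f ω, g ω, h ω)) (g := fun ω => (f ω, g ω)),
      entropy_congr P (f := fun ω => (g ω, h ω)) (g := g)]
    · exact fun ω ω' => by simpa using hgh ω ω'
    · exact fun ω ω' => by simpa using fun _ => hgh ω ω'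
  rw [← h3]
  refine h1.trans (le_of_eq ?_)
  rw [condEntropy, entropy_eq_sum P h, entropy_eq_sum P (fun ω => (f ω, h ω))]
  simp only
  rw [h2]
  ring

/-- Cross-entropy against the uniform kernel. -/
theorem condEntropy_le_logb_card {P : Ω → ℝ} (hP : P ∈ stdSimplex ℝ Ω) [Nonempty A] (f : Ω → A)
    (g : Ω → B) : condEntropy P f g ≤ Real.logb 2 (Fintype.card A) := by
  have hc : (0 : ℝ) < Fintype.card A := by exact_mod_cast Fintype.card_pos
  refine (condEntropy_le_crossEntropy hP f g (fun _ _ => (Fintype.card A : ℝ)⁻¹)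
    (fun _ _ => by positivity) (fun _ => by simp [hc.ne']) (fun _ _ => by positivity)).trans ?_
  rw [← Finset.sum_mul, hP.2, Real.logb_inv]
  simp

/-- Subadditivity of entropy. -/
theorem entropy_pi_le_sum {ι : Type*} [Fintype ι] [DecidableEq ι] {P : Ω → ℝ} (hP : P ∈ stdSimplex ℝ Ω)
    (f : ι → Ω → A) : entropy P (fun ω i => f i ω) ≤ ∑ i, entropy P (f i) := by
  refine (entropy_le_crossEntropy hP (fun ω i => f i ω) (fun a => ∏ i, law P (f i) (a i))
    (fun a => Finset.prod_nonneg fun i _ => law_nonneg hP.1 _ _) ?_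
    (fun ω h => Finset.prod_pos fun i _ => h.trans_le (le_law hP.1 (f i) ω))).trans ?_
  · have := Finset.prod_univ_sum (fun _ : ι => (Finset.univ : Finset A))
      (fun i a => law P (f i) a)
    rw [Fintype.piFinset_univ] at this
    rw [← this]
    simp [sum_law, hP.2]
  · simp only [entropy_eq_sum]
    rw [Finset.sum_neg_distrib, Finset.sum_comm, neg_le_neg_iff]
    refine Finset.sum_le_sum fun ω _ => le_of_eq ?_
    rw [← Finset.mul_sum]
    rcases (hP.1 ω).eq_or_lt with h0 | h0
    · simp [← h0]
    · rw [Real.logb_prod _ _ fun i _ => (h0.trans_le (le_law hP.1 (f i) ω)).ne']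

open Classical in
/-- A weak form of Fano's inequality. -/
theorem condEntropy_le_fano {P : Ω → ℝ} (hP : P ∈ stdSimplex ℝ Ω) [Nonempty A] (f : Ω → A)
    (g : Ω → B) (d : B → A) :
    condEntropy P f g ≤
      1 + (∑ ω, P ω * if d (g ω) = f ω then 0 else 1) * Real.logb 2 (Fintype.card A) := by
  have hc : (0 : ℝ) < Fintype.card A := by exact_mod_cast Fintype.card_pos
  -- The kernel is half a point mass at the guess plus half the uniform law: at most one bit for a
  -- correct guess, `1 + log |A|` bits for a wrong one.
  refine (condEntropy_le_crossEntropy hP f g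
    (fun b a => (if d b = a then 1 / 2 else 0) + (2 * (Fintype.card A : ℝ))⁻¹)
    (fun b a => by positivity) (fun b => ?_) (fun ω _ => by positivity)).trans ?_
  · rw [Finset.sum_add_distrib]
    simp only [Finset.sum_ite_eq, Finset.mem_univ, if_true, Finset.sum_const, Finset.card_univ,
      nsmul_eq_mul]
    apply le_of_eq
    field_simp
    norm_num
  · have hpt : ∀ ω, -(P ω * Real.logb 2
        ((if d (g ω) = f ω then 1 / 2 else 0) + (2 * (Fintype.card A : ℝ))⁻¹)) ≤
        P ω + (P ω * if d (g ω) = f ω then 0 else 1) * Real.logb 2 (Fintype.card A) := by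
      intro ω
      have h2 : Real.logb 2 (1 / 2) = -1 := by
        rw [one_div, Real.logb_inv, Real.logb_self_eq_one (by norm_num)]
      split_ifs with h
      · have : Real.logb 2 (1 / 2) ≤ Real.logb 2 (1 / 2 + (2 * (Fintype.card A : ℝ))⁻¹) :=
          Real.logb_le_logb_of_le (by norm_num) (by norm_num)
            (le_add_of_nonneg_right (by positivity))
        nlinarith [hP.1 ω]
      · rw [zero_add, Real.logb_inv, Real.logb_mul (by norm_num) hc.ne',
          Real.logb_self_eq_one (by norm_num)]
        apply le_of_eq
        ring
    rw [← Finset.sum_neg_distrib]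
    refine (Finset.sum_le_sum fun ω _ => hpt ω).trans ?_
    rw [Finset.sum_add_distrib, hP.2, Finset.sum_mul]

end Entropy

/-! ### Csiszár's sum identity by telescoping. -/

section Telescoping

variable {Ω A Z T : Type*} {n : ℕ}

/-- The sequence whose entries before time `k` are those of `z` and whose later ones are those
of `τ`. -/
def hybrid (z : Ω → Fin n → Z) (τ : Ω → Fin n → T) (k : ℕ) (ω : Ω) : Fin n → Z ⊕ T :=
  fun t => if (t : ℕ) < k then Sum.inl (z ω t) else Sum.inr (τ ω t)

/-- The auxiliary random variable at time `t`: the variable `M`, the past of `z` and the future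
of `τ`. -/
def auxVar (M : Ω → A) (z : Ω → Fin n → Z) (τ : Ω → Fin n → T) (t : Fin n) (ω : Ω) :
    A × (Fin n → Option (Z ⊕ T)) :=
  (M ω, fun r => if r = t then none else some (hybrid z τ t ω r))

theorem hybrid_eq_iff (z : Ω → Fin n → Z) (τ : Ω → Fin n → T) (k : ℕ) (ω ω' : Ω) :
    hybrid z τ k ω = hybrid z τ k ω' ↔
      ∀ r : Fin n, ((r : ℕ) < k → z ω r = z ω' r) ∧ (k ≤ (r : ℕ) → τ ω r = τ ω' r) := by
  rw [funext_iff]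
  refine forall_congr' fun r => ?_
  by_cases h : (r : ℕ) < k
  · simp [hybrid, h]
  · simp [hybrid, h, not_lt.1 h]

/-- Position `t` is blanked by `none`, so only the strict past of `z` and the strict future of `τ`
are compared. This is the fibre description that `entropy_congr` needs. -/
theorem auxVar_eq_iff (M : Ω → A) (z : Ω → Fin n → Z) (τ : Ω → Fin n → T) (t : Fin n)
    (ω ω' : Ω) : auxVar M z τ t ω = auxVar M z τ t ω' ↔
      M ω = M ω' ∧ ∀ r, (r < t → z ω r = z ω' r) ∧ (t < r → τ ω r = τ ω' r) := by
  rw [auxVar, auxVar, Prod.mk.injEq, funext_iff]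
  refine and_congr_right fun _ => forall_congr' fun r => ?_
  rcases lt_trichotomy r t with h | h | h
  · simp [hybrid, h, h.ne, h.not_gt]
  · simp [h]
  · simp [hybrid, h, h.ne', h.not_gt]

variable [Fintype Ω] [Fintype A] [Fintype Z] [Fintype T]

/-- Csiszár's sum identity, in the form of a telescoping sum. -/
theorem sum_mutualInfo_auxVar (P : Ω → ℝ) (M : Ω → A) (z : Ω → Fin n → Z) (τ : Ω → Fin n → T) :
    ∑ t, (mutualInfo P (auxVar M z τ t) (fun ω => z ω t) -
        mutualInfo P (auxVar M z τ t) (fun ω => τ ω t)) =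
      ∑ t, entropy P (fun ω => z ω t) - ∑ t, entropy P (fun ω => τ ω t) +
        entropy P (fun ω => (M ω, τ ω)) - entropy P (fun ω => (M ω, z ω)) := by
  -- Adjoining `z` at time `t` to the auxiliary gives the hybrid with switch at `t + 1`; adjoining
  -- `τ` gives the switch at `t`. The differences of mutual informations therefore telescope in `F`.
  set F : ℕ → ℝ := fun k => entropy P (fun ω => (M ω, hybrid z τ k ω)) with hF
  have h1 : ∀ t : Fin n, entropy P (fun ω => (auxVar M z τ t ω, z ω t)) = F (t + 1) := by
    refine fun t => entropy_congr P fun ω ω' => ?_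
    rw [Prod.mk.injEq (auxVar M z τ t ω), auxVar_eq_iff, Prod.mk.injEq (M ω), hybrid_eq_iff, and_assoc]
    refine and_congr_right fun _ => ⟨fun h r => ⟨fun hr => ?_, fun hr => ?_⟩, fun h =>
      ⟨fun r => ⟨fun hr => ?_, fun hr => ?_⟩, ?_⟩⟩
    · rcases (Nat.lt_succ_iff.1 hr).lt_or_eq with h' | h'
      · exact (h.1 r).1 h'
      · rw [Fin.ext h']; exact h.2
    · exact (h.1 r).2 hr
    · exact (h r).1 (Nat.lt_succ_of_lt hr)
    · exact (h r).2 hr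
    · exact (h t).1 (Nat.lt_succ_self _)
  have h2 : ∀ t : Fin n, entropy P (fun ω => (auxVar M z τ t ω, τ ω t)) = F t := by
    refine fun t => entropy_congr P fun ω ω' => ?_
    rw [Prod.mk.injEq (auxVar M z τ t ω), auxVar_eq_iff, Prod.mk.injEq (M ω), hybrid_eq_iff, and_assoc]
    refine and_congr_right fun _ => ⟨fun h r => ⟨fun hr => ?_, fun hr => ?_⟩, fun h =>
      ⟨fun r => ⟨fun hr => ?_, fun hr => ?_⟩, ?_⟩⟩
    · exact (h.1 r).1 hr
    · rcases hr.lt_or_eq with h' | h'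
      · exact (h.1 r).2 h'
      · rw [← Fin.ext h']; exact h.2
    · exact (h r).1 hr
    · exact (h r).2 (le_of_lt hr)
    · exact (h t).2 le_rfl
  have h3 : F 0 = entropy P (fun ω => (M ω, τ ω)) := by
    refine entropy_congr P fun ω ω' => ?_
    rw [Prod.mk.injEq, Prod.mk.injEq, hybrid_eq_iff]
    simp [funext_iff]
  have h4 : F n = entropy P (fun ω => (M ω, z ω)) := by
    refine entropy_congr P fun ω ω' => ?_
    rw [Prod.mk.injEq, Prod.mk.injEq, hybrid_eq_iff]
    simp [funext_iff, fun r : Fin n => r.2.not_ge]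
  have h5 : ∑ t : Fin n, (F t - F (t + 1)) = F 0 - F n := by
    rw [Fin.sum_univ_eq_sum_range (fun k => F k - F (k + 1)), Finset.sum_range_sub']
  rw [h3, h4] at h5
  have h6 : ∀ t, mutualInfo P (auxVar M z τ t) (fun ω => z ω t) -
        mutualInfo P (auxVar M z τ t) (fun ω => τ ω t) =
      entropy P (fun ω => z ω t) - entropy P (fun ω => τ ω t) + (F t - F (t + 1)) := by
    intro t
    rw [mutualInfo, mutualInfo, condEntropy, condEntropy, h1, h2]
    ring
  simp only [h6]
  rw [Finset.sum_add_distrib, Finset.sum_sub_distrib, h5]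
  ring

end Telescoping

/-! ### Choosing between two auxiliary variables. -/

section Selection

variable {Ω S Y Z U V : Type*} [Fintype Ω] [Fintype S] [Fintype Y] [Fintype Z] [Fintype U]
  [Fintype V]

theorem condEntropy_pair_left (P : Ω → ℝ) (y : Ω → Y) (s : Ω → S) (u : Ω → U) :
    condEntropy P (fun ω => (s ω, y ω)) u =
      condEntropy P s u + condEntropy P y (fun ω => (s ω, u ω)) := by
  have : entropy P (fun ω => ((s ω, y ω), u ω)) = entropy P (fun ω => (y ω, s ω, u ω)) :=
    entropy_congr P fun ω ω' => by simp; tauto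
  rw [condEntropy, condEntropy, condEntropy, this]
  ring

theorem mutualInfo_eq (P : Ω → ℝ) (f : Ω → U) (g : Ω → V) :
    mutualInfo P f g = entropy P g - condEntropy P g f := by
  have : entropy P (fun ω => (f ω, g ω)) = entropy P (fun ω => (g ω, f ω)) :=
    entropy_congr P fun ω ω' => by simp; tauto
  rw [mutualInfo, condEntropy, condEntropy, this]
  ring

theorem mutualInfo_le_mutualInfo_pair {P : Ω → ℝ} (hP : P ∈ stdSimplex ℝ Ω) (y : Ω → Y)
    (s : Ω → S) (u : Ω → U) :
    mutualInfo P u s ≤ mutualInfo P u (fun ω => (s ω, y ω)) := by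
  have h1 := condEntropy_le_of_determines hP y (fun ω => (s ω, u ω)) s (fun ω ω' => by simp; tauto)
  have h2 := condEntropy_pair_left P y s u
  have h3 : entropy P (fun ω => (s ω, y ω)) = entropy P (fun ω => (y ω, s ω)) :=
    entropy_congr P fun ω ω' => by simp; tauto
  rw [mutualInfo_eq, mutualInfo_eq, h2, h3]
  rw [condEntropy.eq_1 P y s] at h1
  linarith

/-- If refining the auxiliary variable `v` to `u` decreases `I(·; Z) - I(·; S)`, then it decreases
`I(·; Z) - I(·; S, Y)` as well. -/
theorem mutualInfo_sub_le_or {P : Ω → ℝ} (hP : P ∈ stdSimplex ℝ Ω) (y : Ω → Y) (z : Ω → Z)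
    (s : Ω → S) (u : Ω → U) (v : Ω → V) (huv : ∀ ω ω', u ω = u ω' → v ω = v ω') :
    mutualInfo P v z - mutualInfo P v s ≤ mutualInfo P u z - mutualInfo P u s ∨
      mutualInfo P u z - mutualInfo P u (fun ω => (s ω, y ω)) ≤
        mutualInfo P v z - mutualInfo P v (fun ω => (s ω, y ω)) := by
  -- The two functionals differ by I(·;Y|S) = H(Y|S) - H(Y|S,·), which can only grow under
  -- refinement.
  have h1 := condEntropy_le_of_determines hP y (fun ω => (s ω, u ω)) (fun ω => (s ω, v ω))
    (fun ω ω' => by simpa using fun h h' => ⟨h, huv _ _ h'⟩)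
  simp only [mutualInfo_eq, condEntropy_pair_left]
  by_contra! h
  linarith [h.1, h.2]

end Selection

/-! ### Averaging rate regions over time. -/

section Averaging

/-- The excess `a t + b t - c t` is nonnegative, so it can be taken off the corner `(a t, b t)` in
fixed proportions `l : 1 - l` at all times, together with a constant positive slack. The resulting
points average exactly to `R`. They may have negative coordinates, which the regions allow. -/
theorem mem_of_average_lt {n : ℕ} (hn : 0 < n) {K : Set (ℝ × ℝ)} (hK : Convex ℝ K)
    {a b c : Fin n → ℝ} (hc : ∀ t, c t ≤ a t + b t)
    (hmem : ∀ t, ∀ r : ℝ × ℝ, r.1 < a t → r.2 < b t → r.1 + r.2 < c t → r ∈ K)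
    {R : ℝ × ℝ} (ha : n * R.1 < ∑ t, a t) (hb : n * R.2 < ∑ t, b t)
    (hs : n * (R.1 + R.2) < ∑ t, c t) : R ∈ K := by
  have hn' : (0 : ℝ) < n := by exact_mod_cast hn
  obtain ⟨d₁, hd₁⟩ : ∃ d, n * d = ∑ t, a t - n * R.1 := ⟨_, mul_div_cancel₀ _ hn'.ne'⟩
  obtain ⟨d₂, hd₂⟩ : ∃ d, n * d = ∑ t, b t - n * R.2 := ⟨_, mul_div_cancel₀ _ hn'.ne'⟩
  obtain ⟨k, hk⟩ : ∃ k, n * k = ∑ t, (a t + b t - c t) := ⟨_, mul_div_cancel₀ _ hn'.ne'⟩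
  have hk' : n * k = ∑ t, a t + ∑ t, b t - ∑ t, c t := by
    rw [hk, Finset.sum_sub_distrib, Finset.sum_add_distrib]
  have hd₁0 : 0 < d₁ := pos_of_mul_pos_right (by rw [hd₁]; linarith) hn'.le
  have hd₂0 : 0 < d₂ := pos_of_mul_pos_right (by rw [hd₂]; linarith) hn'.le
  have hkd : k < d₁ + d₂ := lt_of_mul_lt_mul_left (by rw [hk', mul_add, hd₁, hd₂]; linarith) hn'.le
  -- `d₁`, `d₂` are the average slacks and `k < d₁ + d₂` the average excess; splitting `k` in the
  -- ratio of the slacks keeps each share below its slack.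
  set l := d₁ / (d₁ + d₂) with hl
  have hl1 : l * (d₁ + d₂) = d₁ := div_mul_cancel₀ _ (by positivity)
  have hl0 : 0 < l := by positivity
  have hl2 : 0 < 1 - l := by
    have : l < 1 := (div_lt_one (by positivity)).2 (by linarith)
    linarith
  have hlk : l * k < d₁ := by nlinarith
  have hlk' : (1 - l) * k < d₂ := by nlinarith
  have key : ∑ t, (n : ℝ)⁻¹ • ((a t - (l * (a t + b t - c t) + (d₁ - l * k)),
      b t - ((1 - l) * (a t + b t - c t) + (d₂ - (1 - l) * k))) : ℝ × ℝ) ∈ K := by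
    refine hK.sum_mem (fun _ _ => by positivity) (by simp [hn'.ne']) fun t _ => hmem t _ ?_ ?_ ?_
    · have := mul_nonneg hl0.le (sub_nonneg.2 (hc t))
      simp only; linarith
    · have := mul_nonneg hl2.le (sub_nonneg.2 (hc t))
      simp only; linarith
    · simp only; linarith
  convert key
  rw [← Finset.smul_sum, eq_inv_smul_iff₀ hn'.ne']
  ext
  · simp only [Prod.fst_sum, Prod.smul_fst, smul_eq_mul]
    rw [Finset.sum_sub_distrib, Finset.sum_add_distrib, ← Finset.mul_sum, ← hk]
    simp
    linarith
  · simp only [Prod.snd_sum, Prod.smul_snd, smul_eq_mul]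
    rw [Finset.sum_sub_distrib, Finset.sum_add_distrib, ← Finset.mul_sum, ← hk]
    simp
    linarith

end Averaging

/-! ### Sums over product laws. -/

section ProductLaw

variable {ι A : Type*} [Fintype ι] [DecidableEq ι] [Fintype A]

theorem sum_pi_prod (κ : ι → A → ℝ) : ∑ w : ι → A, ∏ t, κ t (w t) = ∏ t, ∑ a, κ t a := by
  have := Finset.prod_univ_sum (fun _ : ι => (Finset.univ : Finset A)) κ
  rwa [Fintype.piFinset_univ, eq_comm] at this

/-- Under a product law, a coordinate is independent of functions of the other coordinates. -/
theorem sum_pi_prod_mul {κ : ι → A → ℝ} (i : ι) (hκ : ∑ a, κ i a = 1) (F : (ι → A) → ℝ)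
    (hF : ∀ w a, F (Function.update w i a) = F w) (ψ : A → ℝ) :
    ∑ w : ι → A, (∏ t, κ t (w t)) * (F w * ψ (w i)) =
      ∑ w : ι → A, (∏ t, κ t (w t)) * (F w * ∑ a, κ i a * ψ a) := by
  have hsplit : ∀ φ : A → ℝ, ∑ w : ι → A, (∏ t, κ t (w t)) * (F w * φ (w i)) =
      ∑ v : {j // j ≠ i} → A, (∏ j : {j // j ≠ i}, κ j (v j)) * ∑ a, κ i a *
        (F ((Equiv.funSplitAt i A).symm (a, v)) * φ a) := by
    intro φ
    rw [← (Equiv.funSplitAt i A).symm.sum_comp, Fintype.sum_prod_type_right]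
    refine Finset.sum_congr rfl fun v _ => ?_
    rw [Finset.mul_sum]
    refine Finset.sum_congr rfl fun a _ => ?_
    have h1 : (Equiv.funSplitAt i A).symm (a, v) i = a := by simp
    have h2 : ∀ j : {j // j ≠ i}, (Equiv.funSplitAt i A).symm (a, v) j = v j := by
      rintro ⟨j, hj⟩; simp [hj]
    rw [Fintype.prod_eq_mul_prod_subtype_ne _ i, h1]
    simp only [h2]
    ring
  rw [hsplit ψ, hsplit fun _ => ∑ a, κ i a * ψ a]
  refine Finset.sum_congr rfl fun v _ => ?_
  congr 1
  have hconst : ∀ a b, F ((Equiv.funSplitAt i A).symm (a, v)) =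
      F ((Equiv.funSplitAt i A).symm (b, v)) := by
    intro a b
    rw [← hF ((Equiv.funSplitAt i A).symm (b, v)) a]
    congr 1
    ext j
    by_cases hj : j = i
    · subst hj; simp
    · simp [hj]
  cases isEmpty_or_nonempty A
  · simp
  obtain ⟨a₀⟩ := ‹Nonempty A›
  simp only [fun a => hconst a a₀]
  rw [← Finset.sum_mul, hκ, one_mul, Finset.mul_sum]
  exact Finset.sum_congr rfl fun a _ => by ring

end ProductLaw

/-! ### From random variables to points of the outer region. -/

section SingleLetter

variable {Ω X S Y Z U : Type*} [Fintype Ω] [Fintype X] [Fintype S] [Fintype Y] [Fintype Z]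
  [Fintype U]

theorem mutualInfo_comp_equiv {V B : Type*} [Fintype V] [Fintype B] (P : Ω → ℝ) (e : U ≃ V)
    (f : Ω → U) (g : Ω → B) : mutualInfo P (fun ω => e (f ω)) g = mutualInfo P f g := by
  rw [mutualInfo, mutualInfo, condEntropy, condEntropy,
    entropy_congr P (f := fun ω => e (f ω)) (g := f) (by simp),
    entropy_congr P (f := fun ω => (e (f ω), g ω)) (g := fun ω => (f ω, g ω)) (by simp)]

/-- Random variables whose joint law factors through the channel yield points of the outer
region. -/
theorem mem_outerRegion_of_law (ch : Channel X S Y Z) {P : Ω → ℝ} (hP : P ∈ stdSimplex ℝ Ω)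
    (fX : Ω → X) (fY : Ω → Y) (fZ : Ω → Z) (fS : Ω → S) (fU : Ω → U)
    (hS : law P fS = ch.stateLaw)
    (hlaw : ∀ x y z s u, law P (fun ω => (fX ω, fY ω, fZ ω, fS ω, fU ω)) (x, y, z, s, u) =
      law P (fun ω => ((fX ω, fU ω), fS ω)) ((x, u), s) * ch.trans x s (y, z))
    {r : ℝ × ℝ} (h1 : r.1 < condMutualInfo P fX fY fS)
    (h2 : r.2 < mutualInfo P fU fZ - mutualInfo P fU fS)
    (h3 : r.1 + r.2 < condMutualInfo P fX fY fS +
      (mutualInfo P fU fZ - mutualInfo P fU (fun ω => (fS ω, fY ω)))) :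
    r ∈ outerRegion ch := by
  classical
  set e := Fintype.equivFin U
  obtain ⟨ω₀⟩ : Nonempty Ω := by
    by_contra h
    rw [not_nonempty_iff] at h
    simpa using hP.2
  -- At states of probability zero any probability law will do; a point mass is used.
  set q : S → X × Fin (Fintype.card U) → ℝ := fun s =>
    if ch.stateLaw s = 0 then Pi.single (fX ω₀, e (fU ω₀)) 1
    else fun p => law P (fun ω => ((fX ω, fU ω), fS ω)) ((p.1, e.symm p.2), s) / ch.stateLaw s
    with hq
  have hsum : ∀ s, ∑ p, law P (fun ω => ((fX ω, fU ω), fS ω)) (p, s) = ch.stateLaw s := fun s => by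
    rw [sum_law_pair P (fun ω => (fX ω, fU ω)) fS s, hS]
  refine ⟨Fintype.card U, q, fun s => ?_, ?_⟩
  · by_cases h : ch.stateLaw s = 0
    · simp only [hq, h, if_true]
      exact single_mem_stdSimplex ℝ _
    · simp only [hq, h, if_false]
      refine ⟨fun p => div_nonneg (law_nonneg hP.1 _ _) (ch.stateLaw_mem.1 s), ?_⟩
      rw [← Finset.sum_div, div_eq_one_iff_eq h, ← hsum s]
      exact ((Equiv.refl X).prodCongr e.symm).sum_comp
        (fun p => law P (fun ω => ((fX ω, fU ω), fS ω)) (p, s))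
  · have hjoint : jointLaw ch q = law P (fun ω => (fX ω, fY ω, fZ ω, fS ω, e (fU ω))) := by
      funext ⟨x, y, z, s, k⟩
      have hk : law P (fun ω => (fX ω, fY ω, fZ ω, fS ω, e (fU ω))) (x, y, z, s, k) =
          law P (fun ω => (fX ω, fY ω, fZ ω, fS ω, fU ω)) (x, y, z, s, e.symm k) :=
        law_congr P fun ω => by simp [Equiv.eq_symm_apply]
      rw [hk, hlaw]
      simp only [jointLaw, hq]
      congr 1
      split_ifs with h
      · rw [h, zero_mul, eq_comm]
        refine le_antisymm ?_ (law_nonneg hP.1 _ _)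
        rw [← h, ← hsum s]
        exact Finset.single_le_sum
          (f := fun p => law P (fun ω => ((fX ω, fU ω), fS ω)) (p, s))
          (fun p _ => law_nonneg hP.1 _ _) (Finset.mem_univ (x, e.symm k))
      · exact mul_div_cancel₀ _ h
    rw [← mutualInfo_comp_equiv P e fU fZ, ← mutualInfo_comp_equiv P e fU fS] at h2
    rw [← mutualInfo_comp_equiv P e fU fZ,
      ← mutualInfo_comp_equiv P e fU (fun ω => (fS ω, fY ω)), ← add_sub_assoc] at h3
    rw [hjoint]
    simp only [rateRegion, Set.mem_ofPred_eq, condMutualInfo, mutualInfo, condEntropy,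
      entropy_law] at h1 h2 h3 ⊢
    exact ⟨h1, h2, h3⟩

end SingleLetter

/-! ### The joint law induced by a code. -/

section Block

variable {X S Y Z : Type*} [Fintype S] [Fintype Y] [Fintype Z] {n my mz : ℕ}

/-- The joint law of the messages, the states and the outputs when a code is used. -/
def blockLaw (ch : Channel X S Y Z) (c : Code X S Y Z n my mz) :
    Fin my × Fin mz × (Fin n → S) × (Fin n → Y × Z) → ℝ :=
  fun ω => ((my : ℝ) * mz)⁻¹ * ((∏ t, ch.stateLaw (ω.2.2.1 t)) *
    ∏ t, ch.trans (c.enc ω.1 ω.2.1 ω.2.2.1 t) (ω.2.2.1 t) (ω.2.2.2 t))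

variable (ch : Channel X S Y Z) (c : Code X S Y Z n my mz)

theorem sum_blockLaw_mul (φ : Fin my × Fin mz × (Fin n → S) × (Fin n → Y × Z) → ℝ) :
    ∑ ω, blockLaw ch c ω * φ ω = ((my : ℝ) * mz)⁻¹ * ∑ i, ∑ j, ∑ s : Fin n → S,
      (∏ t, ch.stateLaw (s t)) * ∑ w : Fin n → Y × Z,
        (∏ t, ch.trans (c.enc i j s t) (s t) (w t)) * φ (i, j, s, w) := by
  simp only [Fintype.sum_prod_type, blockLaw, Finset.mul_sum, mul_assoc]

theorem sum_prod_trans (x : Fin n → X) (s : Fin n → S) :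
    ∑ w : Fin n → Y × Z, ∏ t, ch.trans (x t) (s t) (w t) = 1 := by
  rw [sum_pi_prod (fun t => ch.trans (x t) (s t))]
  exact Finset.prod_eq_one fun t _ => (ch.trans_mem _ _).2

theorem sum_blockLaw_mul_of_messages_states (φ : Fin my × Fin mz × (Fin n → S) → ℝ) :
    ∑ ω, blockLaw ch c ω * φ (ω.1, ω.2.1, ω.2.2.1) = ((my : ℝ) * mz)⁻¹ * ∑ i, ∑ j,
      ∑ s : Fin n → S, (∏ t, ch.stateLaw (s t)) * φ (i, j, s) := by
  rw [sum_blockLaw_mul ch c (fun ω => φ (ω.1, ω.2.1, ω.2.2.1))]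
  simp only [← Finset.sum_mul, sum_prod_trans, one_mul]

theorem sum_prod_stateLaw : ∑ s : Fin n → S, ∏ t, ch.stateLaw (s t) = 1 := by
  rw [sum_pi_prod (fun _ => ch.stateLaw)]
  exact Finset.prod_eq_one fun t _ => ch.stateLaw_mem.2

theorem blockLaw_mem (hy : 0 < my) (hz : 0 < mz) : blockLaw ch c ∈ stdSimplex ℝ _ := by
  refine ⟨fun ω => mul_nonneg (by positivity) (mul_nonneg
    (Finset.prod_nonneg fun t _ => ch.stateLaw_mem.1 _)
    (Finset.prod_nonneg fun t _ => (ch.trans_mem _ _).1 _)), ?_⟩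
  have h := sum_blockLaw_mul_of_messages_states ch c (fun _ => 1)
  have hy' : (my : ℝ) ≠ 0 := by exact_mod_cast hy.ne'
  have hz' : (mz : ℝ) ≠ 0 := by exact_mod_cast hz.ne'
  simp only [mul_one, sum_prod_stateLaw] at h
  rw [h]
  simp
  field_simp

theorem law_eq_sum_mul {Ω A : Type*} [Fintype Ω] (P : Ω → ℝ) (f : Ω → A) (a : A) (p : Ω → Prop)
    [DecidablePred p] (h : ∀ ω, f ω = a ↔ p ω) :
    law P f a = ∑ ω, P ω * if p ω then 1 else 0 := by
  simp [law, Finset.sum_filter, h]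

theorem law_blockLaw_state (hy : 0 < my) (hz : 0 < mz) (t : Fin n) :
    law (blockLaw ch c) (fun ω => ω.2.2.1 t) = ch.stateLaw := by
  classical
  funext a
  have h := sum_blockLaw_mul_of_messages_states ch c (fun p => if p.2.2 t = a then 1 else 0)
  have h2 := sum_pi_prod_mul (κ := fun _ : Fin n => ch.stateLaw) t ch.stateLaw_mem.2 (fun _ => 1)
    (fun _ _ => rfl) (fun b => if b = a then 1 else 0)
  have hy' : (my : ℝ) ≠ 0 := by exact_mod_cast hy.ne'
  have hz' : (mz : ℝ) ≠ 0 := by exact_mod_cast hz.ne'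
  simp only [one_mul] at h2
  rw [← Finset.sum_mul, sum_prod_stateLaw] at h2
  refine (law_eq_sum_mul (blockLaw ch c) _ _ (fun ω => ω.2.2.1 t = a) (fun ω => Iff.rfl)).trans
    (h.trans ?_)
  simp only [h2]
  simp
  field_simp

/-- Without feedback, the output letters are independent given the messages and all states, and the
letter at time `t` depends on these only through the current input and state. An auxiliary ignoring
that letter keeps this factorization. -/
theorem law_blockLaw_singleLetter {U : Type*} (t : Fin n)
    (fU : Fin my × Fin mz × (Fin n → S) × (Fin n → Y × Z) → U)
    (hU : ∀ i j s w a, fU (i, j, s, Function.update w t a) = fU (i, j, s, w))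
    (x : X) (y : Y) (z : Z) (s : S) (u : U) :
    law (blockLaw ch c) (fun ω => (c.enc ω.1 ω.2.1 ω.2.2.1 t, (ω.2.2.2 t).1, (ω.2.2.2 t).2,
      ω.2.2.1 t, fU ω)) (x, y, z, s, u) =
    law (blockLaw ch c) (fun ω => ((c.enc ω.1 ω.2.1 ω.2.2.1 t, fU ω), ω.2.2.1 t)) ((x, u), s) *
      ch.trans x s (y, z) := by
  classical
  rw [law_eq_sum_mul _ _ _ (fun ω => ((c.enc ω.1 ω.2.1 ω.2.2.1 t, fU ω), ω.2.2.1 t) = ((x, u), s) ∧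
      ω.2.2.2 t = (y, z)) (fun ω => by simp only [Prod.ext_iff]; tauto),
    law_eq_sum_mul _ _ _ (fun ω => ((c.enc ω.1 ω.2.1 ω.2.2.1 t, fU ω), ω.2.2.1 t) = ((x, u), s))
      (fun ω => Iff.rfl), sum_blockLaw_mul ch c, sum_blockLaw_mul ch c, mul_assoc]
  refine congrArg (HMul.hMul _) ?_
  rw [Finset.sum_mul]
  refine Finset.sum_congr rfl fun i _ => ?_
  rw [Finset.sum_mul]
  refine Finset.sum_congr rfl fun j _ => ?_
  rw [Finset.sum_mul]
  refine Finset.sum_congr rfl fun σ _ => ?_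
  rw [mul_assoc]
  refine congrArg (HMul.hMul _) ?_
  have h := sum_pi_prod_mul (κ := fun r => ch.trans (c.enc i j σ r) (σ r)) t
    (ch.trans_mem _ _).2
    (fun w => if ((c.enc i j σ t, fU (i, j, σ, w)), σ t) = ((x, u), s) then (1 : ℝ) else 0)
    (fun w a => by simp only [hU]) (fun a => if a = (y, z) then 1 else 0)
  rw [Finset.sum_mul]
  refine Eq.trans (Finset.sum_congr rfl fun w _ => ?_)
    (h.trans (Finset.sum_congr rfl fun w _ => ?_))
  · refine congrArg (HMul.hMul _) ?_
    rw [ite_zero_mul_ite_zero, mul_one]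
  · rw [mul_assoc]
    refine congrArg (HMul.hMul _) ?_
    split_ifs with h'
    · simp only [Prod.mk.injEq] at h'
      simp [h'.1.1, h'.2]
    · simp

/-- The logarithm turns a product law into a sum of per-letter cross-entropies, plus `log C` from
the uniform messages. -/
theorem entropy_eq_of_law_eq {Ω A : Type*} [Fintype Ω] [Fintype A] {P : Ω → ℝ}
    (hP : P ∈ stdSimplex ℝ Ω) (f : Ω → A) {C : ℝ} (hC : 0 < C) (G : Fin n → Ω → ℝ)
    (hG : ∀ ω, 0 < P ω → ∀ t, 0 < G t ω) (hlaw : ∀ ω, law P f (f ω) = C⁻¹ * ∏ t, G t ω) :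
    entropy P f = Real.logb 2 C + ∑ t, -∑ ω, P ω * Real.logb 2 (G t ω) := by
  rw [entropy_eq_sum, Finset.sum_neg_distrib, Finset.sum_comm]
  have : ∀ ω, P ω * Real.logb 2 (law P f (f ω)) =
      P ω * -Real.logb 2 C + ∑ t, P ω * Real.logb 2 (G t ω) := by
    intro ω
    rcases (hP.1 ω).eq_or_lt with h0 | h0
    · simp [← h0]
    · rw [hlaw, Real.logb_mul (inv_pos.2 hC).ne'
        (Finset.prod_pos fun t _ => hG ω h0 t).ne', Real.logb_inv,
        Real.logb_prod _ _ fun t _ => (hG ω h0 t).ne', mul_add, Finset.mul_sum]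
  simp only [this]
  rw [Finset.sum_add_distrib, ← Finset.sum_mul, hP.2]
  ring

theorem blockLaw_pos {ω : Fin my × Fin mz × (Fin n → S) × (Fin n → Y × Z)}
    (h : 0 < blockLaw ch c ω) (t : Fin n) : 0 < ch.stateLaw (ω.2.2.1 t) ∧
      0 < ch.trans (c.enc ω.1 ω.2.1 ω.2.2.1 t) (ω.2.2.1 t) (ω.2.2.2 t) := by
  have h1 := right_ne_zero_of_mul h.ne'
  exact ⟨(ch.stateLaw_mem.1 _).lt_of_ne'
      (Finset.prod_ne_zero_iff.1 (left_ne_zero_of_mul h1) t (Finset.mem_univ t)),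
    ((ch.trans_mem _ _).1 _).lt_of_ne'
      (Finset.prod_ne_zero_iff.1 (right_ne_zero_of_mul h1) t (Finset.mem_univ t))⟩

theorem entropy_state_le (hy : 0 < my) (hz : 0 < mz) (t : Fin n) :
    entropy (blockLaw ch c) (fun ω => ω.2.2.1 t) ≤
      -∑ ω, blockLaw ch c ω * Real.logb 2 (ch.stateLaw (ω.2.2.1 t)) :=
  entropy_le_crossEntropy (blockLaw_mem ch c hy hz) _ ch.stateLaw ch.stateLaw_mem.1
    ch.stateLaw_mem.2.le fun _ h => (blockLaw_pos ch c h t).1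

/-- The messages are uniform and independent of the IID states. Only this direction is needed, so
Gibbs' inequality letter by letter suffices. -/
theorem le_entropy_messages_states (hy : 0 < my) (hz : 0 < mz) :
    Real.logb 2 my + Real.logb 2 mz +
        ∑ t, entropy (blockLaw ch c) (fun ω => ω.2.2.1 t) ≤
      entropy (blockLaw ch c) (fun ω => (ω.1, ω.2.1, ω.2.2.1)) := by
  classical
  have hy' : (0 : ℝ) < my := by exact_mod_cast hy
  have hz' : (0 : ℝ) < mz := by exact_mod_cast hz
  rw [entropy_eq_of_law_eq (blockLaw_mem ch c hy hz) (fun ω => (ω.1, ω.2.1, ω.2.2.1))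
    (mul_pos hy' hz') (fun t ω => ch.stateLaw (ω.2.2.1 t))
    (fun ω h t => (blockLaw_pos ch c h t).1), Real.logb_mul hy'.ne' hz'.ne']
  · gcongr with t
    exact entropy_state_le ch c hy hz t
  · rintro ⟨i, j, s, w⟩
    refine (law_eq_sum_mul (blockLaw ch c) _ _ (fun ω => (ω.1, ω.2.1, ω.2.2.1) = (i, j, s))
      (fun ω => Iff.rfl)).trans ?_
    refine (sum_blockLaw_mul_of_messages_states ch c
      (fun p => if p = (i, j, s) then 1 else 0)).trans ?_
    simp [ite_and]

/-- The law of the output `y` of the first receiver given the input `x` and the state `s`. -/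
def transY (x : X) (s : S) (y : Y) : ℝ := ∑ z, ch.trans x s (y, z)

/-- Summing out the Z-letters leaves a product of `stateLaw` and `transY` factors, whose
cross-entropies dominate the single-letter entropies. -/
theorem le_entropy_messages_states_outputs [Fintype X] (hy : 0 < my) (hz : 0 < mz) :
    Real.logb 2 my + Real.logb 2 mz +
        ∑ t, (entropy (blockLaw ch c) (fun ω => ω.2.2.1 t) +
          condEntropy (blockLaw ch c) (fun ω => (ω.2.2.2 t).1)
            (fun ω => (c.enc ω.1 ω.2.1 ω.2.2.1 t, ω.2.2.1 t))) ≤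
      entropy (blockLaw ch c) (fun ω => (ω.1, ω.2.1, fun t => (ω.2.2.1 t, (ω.2.2.2 t).1))) := by
  classical
  have hy' : (0 : ℝ) < my := by exact_mod_cast hy
  have hz' : (0 : ℝ) < mz := by exact_mod_cast hz
  have hP := blockLaw_mem ch c hy hz
  have hpos : ∀ ω, 0 < blockLaw ch c ω → ∀ t, 0 < transY ch (c.enc ω.1 ω.2.1 ω.2.2.1 t)
      (ω.2.2.1 t) (ω.2.2.2 t).1 := fun ω h t =>
    (blockLaw_pos ch c h t).2.trans_le (Finset.single_le_sum
      (f := fun z => ch.trans (c.enc ω.1 ω.2.1 ω.2.2.1 t) (ω.2.2.1 t) ((ω.2.2.2 t).1, z))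
      (fun z _ => (ch.trans_mem _ _).1 _) (Finset.mem_univ (ω.2.2.2 t).2))
  rw [entropy_eq_of_law_eq hP
    (fun ω => (ω.1, ω.2.1, fun t => (ω.2.2.1 t, (ω.2.2.2 t).1)))
    (mul_pos hy' hz') (fun t ω => ch.stateLaw (ω.2.2.1 t) *
      transY ch (c.enc ω.1 ω.2.1 ω.2.2.1 t) (ω.2.2.1 t) (ω.2.2.2 t).1)
    (fun ω h t => mul_pos (blockLaw_pos ch c h t).1 (hpos ω h t)), Real.logb_mul hy'.ne' hz'.ne']
  · gcongr with t
    have h1 := entropy_state_le ch c hy hz t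
    have h2 := condEntropy_le_crossEntropy hP (fun ω => (ω.2.2.2 t).1)
      (fun ω => (c.enc ω.1 ω.2.1 ω.2.2.1 t, ω.2.2.1 t)) (fun p y => transY ch p.1 p.2 y)
      (fun p y => Finset.sum_nonneg fun z _ => (ch.trans_mem _ _).1 _)
      (fun p => by
        have := (ch.trans_mem p.1 p.2).2
        rw [Fintype.sum_prod_type] at this
        exact this.le)
      (fun ω h => hpos ω h t)
    refine (add_le_add h1 h2).trans (le_of_eq ?_)
    rw [← neg_add, ← Finset.sum_add_distrib]
    congr 1
    refine Finset.sum_congr rfl fun ω _ => ?_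
    rcases (hP.1 ω).eq_or_lt with h0 | h0
    · simp [← h0]
    · rw [Real.logb_mul (blockLaw_pos ch c h0 t).1.ne' (hpos ω h0 t).ne', mul_add]
  · rintro ⟨i, j, s, w⟩
    have hiff : ∀ ω : Fin my × Fin mz × (Fin n → S) × (Fin n → Y × Z),
        (ω.1, ω.2.1, fun t => (ω.2.2.1 t, (ω.2.2.2 t).1)) =
          ((i, j, fun t => (s t, (w t).1)) : Fin my × Fin mz × (Fin n → S × Y)) ↔
        (ω.1 = i ∧ ω.2.1 = j ∧ ω.2.2.1 = s) ∧ ∀ t, (ω.2.2.2 t).1 = (w t).1 := by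
      intro ω
      simp only [Prod.mk.injEq, funext_iff, forall_and]
      tauto
    have hw := sum_pi_prod (fun (t : Fin n) (a : Y × Z) =>
      if a.1 = (w t).1 then ch.trans (c.enc i j s t) (s t) a else 0)
    simp only [Finset.prod_ite_zero, Finset.mem_univ, forall_const] at hw
    have ht : ∀ t, (∑ a : Y × Z,
        if a.1 = (w t).1 then ch.trans (c.enc i j s t) (s t) a else 0) =
        transY ch (c.enc i j s t) (s t) (w t).1 := by
      intro t
      rw [Fintype.sum_prod_type_right, transY]
      simp
    simp only [ht] at hw
    rw [law_eq_sum_mul _ _ _ _ hiff, sum_blockLaw_mul ch c]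
    simp only [ite_and, mul_ite, mul_one, mul_zero]
    rw [Fintype.sum_eq_single i (fun i' hi => by simp [hi]),
      Fintype.sum_eq_single j (fun j' hj => by simp [hj]),
      Fintype.sum_eq_single s (fun s' hs => by simp [hs])]
    simp only [if_true]
    rw [hw, Finset.prod_mul_distrib]

end Block

/-! ### The weak converse and the passage to the limit. -/

section Converse

variable {X S Y Z : Type*} [Fintype X] [Fintype S] [Fintype Y] [Fintype Z] {n my mz : ℕ}

omit [Fintype X] in
theorem errorProb_eq_sum (ch : Channel X S Y Z) (c : Code X S Y Z n my mz) :
    errorProb ch c = ∑ ω, blockLaw ch c ω *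
      if c.decY (fun t => (ω.2.2.2 t).1) ω.2.2.1 = ω.1 ∧ c.decZ (fun t => (ω.2.2.2 t).2) = ω.2.1
        then 0 else 1 := by
  rw [sum_blockLaw_mul, errorProb, div_eq_inv_mul]
  refine congrArg (HMul.hMul _) ?_
  refine Finset.sum_congr rfl fun i _ => Finset.sum_congr rfl fun j _ =>
    Finset.sum_congr rfl fun s _ => ?_
  rw [← (Equiv.arrowProdEquivProdArrow (Fin n) (fun _ => Y) (fun _ => Z)).symm.sum_comp,
    Fintype.sum_prod_type, Finset.mul_sum]
  refine Finset.sum_congr rfl fun y _ => ?_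
  rw [Finset.mul_sum]
  exact Finset.sum_congr rfl fun z _ => mul_assoc _ _ _

/-- Each receiver errs no more often than the pair does, so Fano's inequality applies with the joint
error probability. -/
theorem condEntropy_message_le {Ω A : Type*} [Fintype Ω] [Fintype A] {P : Ω → ℝ}
    (hP : P ∈ stdSimplex ℝ Ω) {m : ℕ} (hm : 0 < m) (f : Ω → Fin m) (g : Ω → A) (d : A → Fin m)
    {ε : ℝ} {E : Ω → Prop} [DecidablePred E] (hE : ∀ ω, E ω → d (g ω) = f ω)
    (hε : ∑ ω, P ω * (if E ω then 0 else 1) = ε) :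
    condEntropy P f g ≤ 1 + ε * Real.logb 2 m := by
  classical
  have : Nonempty (Fin m) := ⟨⟨0, hm⟩⟩
  have h := condEntropy_le_fano hP f g d
  rw [Fintype.card_fin] at h
  refine h.trans ?_
  have hlog : 0 ≤ Real.logb 2 m :=
    Real.logb_nonneg (by norm_num) (by exact_mod_cast hm)
  gcongr
  rw [← hε]
  refine Finset.sum_le_sum fun ω _ => mul_le_mul_of_nonneg_left ?_ (hP.1 ω)
  by_cases h' : E ω
  · simp [h', hE ω h']
  · rw [if_neg h']
    split_ifs <;> norm_num

/-- The weak converse for a single code. -/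
theorem mem_convexHull_outerRegion_of_code (ch : Channel X S Y Z) (c : Code X S Y Z n my mz)
    (hn : 0 < n) (hy : 0 < my) (hz : 0 < mz) {R : ℝ × ℝ}
    (h1 : n * R.1 < Real.logb 2 my - (1 + errorProb ch c * Real.logb 2 my))
    (h2 : n * R.2 < Real.logb 2 mz - (1 + errorProb ch c * Real.logb 2 mz)) :
    R ∈ convexHull ℝ (outerRegion ch) := by
  set P := blockLaw ch c with hPdef
  have hP : P ∈ stdSimplex ℝ _ := blockLaw_mem ch c hy hz
  let M₁ : Fin my × Fin mz × (Fin n → S) × (Fin n → Y × Z) → Fin my := fun ω => ω.1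
  let M₂ : Fin my × Fin mz × (Fin n → S) × (Fin n → Y × Z) → Fin mz := fun ω => ω.2.1
  let x : Fin n → Fin my × Fin mz × (Fin n → S) × (Fin n → Y × Z) → X :=
    fun t ω => c.enc ω.1 ω.2.1 ω.2.2.1 t
  let s : Fin my × Fin mz × (Fin n → S) × (Fin n → Y × Z) → Fin n → S := fun ω => ω.2.2.1
  let y : Fin my × Fin mz × (Fin n → S) × (Fin n → Y × Z) → Fin n → Y :=
    fun ω t => (ω.2.2.2 t).1
  let z : Fin my × Fin mz × (Fin n → S) × (Fin n → Y × Z) → Fin n → Z :=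
    fun ω t => (ω.2.2.2 t).2
  let τ : Fin my × Fin mz × (Fin n → S) × (Fin n → Y × Z) → Fin n → S × Y :=
    fun ω t => (s ω t, y ω t)
  let u := auxVar M₂ z τ
  let v := auxVar M₂ z s
  have hu : ∀ t i j σ w a, u t (i, j, σ, Function.update w t a) = u t (i, j, σ, w) := by
    refine fun t i j σ w a => (auxVar_eq_iff M₂ z τ t _ _).2 ⟨rfl, fun r => ⟨fun h => ?_, fun h => ?_⟩⟩
    · simp [z, Function.update_of_ne h.ne]
    · simp [τ, s, y, Function.update_of_ne h.ne']
  have hv : ∀ t i j σ w a, v t (i, j, σ, Function.update w t a) = v t (i, j, σ, w) := by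
    refine fun t i j σ w a => (auxVar_eq_iff M₂ z s t _ _).2 ⟨rfl, fun r => ⟨fun h => ?_, fun _ => rfl⟩⟩
    simp [z, Function.update_of_ne h.ne]
  have huv : ∀ t ω ω', u t ω = u t ω' → v t ω = v t ω' := by
    intro t ω ω' h
    have h' := (auxVar_eq_iff M₂ z τ t ω ω').1 h
    exact (auxVar_eq_iff M₂ z s t ω ω').2
      ⟨h'.1, fun r => ⟨(h'.2 r).1, fun hr => (Prod.mk.inj ((h'.2 r).2 hr)).1⟩⟩
  let a : Fin n → ℝ := fun t =>
    condMutualInfo P (x t) (fun ω => y ω t) (fun ω => s ω t)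
  have hmemU : ∀ t, ∀ r : ℝ × ℝ, r.1 < a t →
      r.2 < mutualInfo P (u t) (fun ω => z ω t) - mutualInfo P (u t) (fun ω => s ω t) →
      r.1 + r.2 < a t + (mutualInfo P (u t) (fun ω => z ω t) -
        mutualInfo P (u t) (fun ω => τ ω t)) → r ∈ outerRegion ch :=
    fun t r => mem_outerRegion_of_law ch hP (x t) (fun ω => y ω t) (fun ω => z ω t)
      (fun ω => s ω t) (u t) (law_blockLaw_state ch c hy hz t)
      (law_blockLaw_singleLetter ch c t (u t) (hu t))
  have hmemV : ∀ t, ∀ r : ℝ × ℝ, r.1 < a t →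
      r.2 < mutualInfo P (v t) (fun ω => z ω t) - mutualInfo P (v t) (fun ω => s ω t) →
      r.1 + r.2 < a t + (mutualInfo P (v t) (fun ω => z ω t) -
        mutualInfo P (v t) (fun ω => τ ω t)) → r ∈ outerRegion ch :=
    fun t r => mem_outerRegion_of_law ch hP (x t) (fun ω => y ω t) (fun ω => z ω t)
      (fun ω => s ω t) (v t) (law_blockLaw_state ch c hy hz t)
      (law_blockLaw_singleLetter ch c t (v t) (hv t))
  -- One auxiliary per time: the better of `u t`, `v t` meets the R_z bound of `v t` and the
  -- sum-rate bound of `u t` together.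
  have hsel : ∀ t, ∃ p : ℝ × ℝ,
      mutualInfo P (v t) (fun ω => z ω t) - mutualInfo P (v t) (fun ω => s ω t) ≤ p.1 ∧
      mutualInfo P (u t) (fun ω => z ω t) - mutualInfo P (u t) (fun ω => τ ω t) ≤ p.2 ∧
      p.2 ≤ p.1 ∧ ∀ r : ℝ × ℝ, r.1 < a t → r.2 < p.1 → r.1 + r.2 < a t + p.2 →
        r ∈ outerRegion ch := by
    intro t
    rcases mutualInfo_sub_le_or hP (fun ω => y ω t) (fun ω => z ω t) (fun ω => s ω t) (u t) (v t)
      (huv t) with h | h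
    · exact ⟨(_, _), h, le_rfl, sub_le_sub_left (mutualInfo_le_mutualInfo_pair hP _ _ _) _,
        hmemU t⟩
    · exact ⟨(_, _), le_rfl, h, sub_le_sub_left (mutualInfo_le_mutualInfo_pair hP _ _ _) _,
        hmemV t⟩
  choose p hpb hpc hpp hmem using hsel
  have hM₂T := sum_mutualInfo_auxVar P M₂ z τ
  have hM₂S := sum_mutualInfo_auxVar P M₂ z s
  have hsumb := Finset.sum_le_sum fun t (_ : t ∈ Finset.univ) => hpb t
  have hsumc := Finset.sum_le_sum fun t (_ : t ∈ Finset.univ) => hpc t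
  have hZ : entropy P z ≤ ∑ t, entropy P (fun ω => z ω t) := entropy_pi_le_sum hP fun t ω => z ω t
  have hT : entropy P τ ≤ ∑ t, entropy P (fun ω => τ ω t) := entropy_pi_le_sum hP fun t ω => τ ω t
  have hMS := le_entropy_messages_states ch c hy hz
  have hMT := le_entropy_messages_states_outputs ch c hy hz
  have hfano₁ : condEntropy P M₁ τ ≤ 1 + errorProb ch c * Real.logb 2 my :=
    condEntropy_message_le hP hy M₁ τ (fun f => c.decY (fun t => (f t).2) fun t => (f t).1)
      (fun ω h => h.1) (errorProb_eq_sum ch c).symm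
  have hfano₂ : condEntropy P M₂ z ≤ 1 + errorProb ch c * Real.logb 2 mz :=
    condEntropy_message_le hP hz M₂ z c.decZ (fun ω h => h.2) (errorProb_eq_sum ch c).symm
  have : Nonempty (Fin my) := ⟨⟨0, hy⟩⟩
  have : Nonempty (Fin mz) := ⟨⟨0, hz⟩⟩
  have hcard₁ := condEntropy_le_logb_card hP M₁ (fun ω => (M₂ ω, s ω))
  have hcard₂ := condEntropy_le_logb_card hP M₂ (fun ω => (M₁ ω, τ ω))
  rw [Fintype.card_fin] at hcard₁ hcard₂
  have hcond := condEntropy_le_of_determines hP M₁ (fun ω => (M₂ ω, τ ω)) τ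
    (fun ω ω' h => (Prod.mk.inj h).2)
  have hperm : entropy P (fun ω => (M₂ ω, M₁ ω, τ ω)) = entropy P (fun ω => (M₁ ω, M₂ ω, τ ω)) :=
    entropy_congr P fun ω ω' => by simp only [Prod.mk.injEq]; tauto
  have ha : ∑ t, a t = ∑ t, entropy P (fun ω => τ ω t) - ∑ t, (entropy P (fun ω => s ω t) +
      condEntropy P (fun ω => y ω t) (fun ω => (x t ω, s ω t))) := by
    rw [← Finset.sum_sub_distrib]
    refine Finset.sum_congr rfl fun t _ => ?_
    have e1 : entropy P (fun ω => (x t ω, y ω t, s ω t)) =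
        entropy P (fun ω => (y ω t, x t ω, s ω t)) :=
      entropy_congr P fun ω ω' => by simp only [Prod.mk.injEq]; tauto
    have e2 : entropy P (fun ω => (y ω t, s ω t)) = entropy P (fun ω => τ ω t) :=
      entropy_congr P fun ω ω' => by simp only [τ, Prod.mk.injEq]; tauto
    simp only [a, condMutualInfo, condEntropy, e1, e2]
    ring
  have hMT' : Real.logb 2 my + Real.logb 2 mz + ∑ t, (entropy P (fun ω => s ω t) +
      condEntropy P (fun ω => y ω t) (fun ω => (x t ω, s ω t))) ≤
      entropy P (fun ω => (M₁ ω, M₂ ω, τ ω)) := hMT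
  have hMS' : Real.logb 2 my + Real.logb 2 mz + ∑ t, entropy P (fun ω => s ω t) ≤
      entropy P (fun ω => (M₁ ω, M₂ ω, s ω)) := hMS
  simp only [condEntropy.eq_1 P M₁, condEntropy.eq_1 P M₂] at hfano₁ hfano₂ hcard₁ hcard₂ hcond
  refine mem_of_average_lt hn (convex_convexHull ℝ _) (a := a) (b := fun t => (p t).1)
    (c := fun t => a t + (p t).2) (fun t => by simpa using hpp t)
    (fun t r hr1 hr2 hr3 => subset_convexHull ℝ _ (hmem t r hr1 hr2 hr3)) ?_ ?_ ?_
  -- R_y: expand H(M₁,M₂,τ) as H(τ) + H(M₁|τ) + H(M₂|M₁,τ) and bound the last term by log `mz`.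
  · linarith
  -- R_z: H(M₂,S^n) ≥ H(M₁,M₂,S^n) - log `my`, while H(M₂,Z^n) ≤ Σ H(Z_t) plus the Fano term.
  · linarith
  -- Sum rate: the Σ H(τ_t) terms cancel, and H(M₁|M₂,τ) ≤ H(M₁|τ) is bounded by Fano.
  · rw [Finset.sum_add_distrib]
    linarith

/-- Rounding a real number at least 1 down at most halves it, a loss of one bit. -/
theorem logb_floor_ge {r : ℝ} (hr : 0 ≤ r) : r - 1 ≤ Real.logb 2 ⌊(2 : ℝ) ^ r⌋₊ := by
  have h1 : (1 : ℝ) ≤ 2 ^ r := Real.one_le_rpow (by norm_num) hr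
  have h2 : (2 : ℝ) ^ (r - 1) ≤ ⌊(2 : ℝ) ^ r⌋₊ := by
    have h3 : (1 : ℝ) ≤ ⌊(2 : ℝ) ^ r⌋₊ := by exact_mod_cast Nat.one_le_floor_iff _ |>.2 h1
    have h4 := Nat.lt_floor_add_one ((2 : ℝ) ^ r)
    rw [Real.rpow_sub_one (by norm_num)]
    linarith
  rw [Real.le_logb_iff_rpow_le (by norm_num) ((by positivity : (0 : ℝ) < 2 ^ (r - 1)).trans_le h2)]
  exact h2

theorem logb_floor_le {r : ℝ} (hr : 0 ≤ r) : Real.logb 2 ⌊(2 : ℝ) ^ r⌋₊ ≤ r := by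
  have h1 : (1 : ℝ) ≤ 2 ^ r := Real.one_le_rpow (by norm_num) hr
  have h3 : (0 : ℝ) < ⌊(2 : ℝ) ^ r⌋₊ := by exact_mod_cast Nat.floor_pos.2 h1
  rw [Real.logb_le_iff_le_rpow (by norm_num) h3]
  exact Nat.floor_le (by positivity)

theorem Achievable.sub_mem_convexHull {ch : Channel X S Y Z} {R : ℝ × ℝ} (hR : Achievable ch R)
    {η : ℝ} (hη : 0 < η) : R - (η, η) ∈ convexHull ℝ (outerRegion ch) := by
  obtain ⟨h1, h2, hR⟩ := hR
  -- Half of the loss `n * η` pays for the error term in Fano's inequality. The other half exceeds 2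
  -- once `n * η > 4`, covering the rounding bit and Fano's additive bit.
  set ε := η / (2 * (R.1 + R.2 + 1)) with hε
  have hε0 : 0 < ε := by positivity
  have hεR : ε * (R.1 + R.2 + 1) = η / 2 := by rw [hε]; field_simp
  obtain ⟨N, hN⟩ := exists_nat_gt (4 / η)
  obtain ⟨n, ⟨c, hc⟩, hnN, hn⟩ := ((hR ε hε0).and
    ((Filter.eventually_ge_atTop N).and (Filter.eventually_gt_atTop 0))).exists
  have hn' : (0 : ℝ) < n := by exact_mod_cast hn
  have hnη : 4 < n * η := by
    rw [div_lt_iff₀ hη] at hN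
    have : (N : ℝ) ≤ n := by exact_mod_cast hnN
    nlinarith
  have key : ∀ r : ℝ, 0 ≤ r → r ≤ R.1 + R.2 → n * (r - η) <
      Real.logb 2 ⌊(2 : ℝ) ^ ((n : ℝ) * r)⌋₊ -
        (1 + errorProb ch c * Real.logb 2 ⌊(2 : ℝ) ^ ((n : ℝ) * r)⌋₊) := by
    intro r hr hrR
    have l1 := logb_floor_ge (mul_nonneg hn'.le hr)
    have l2 := logb_floor_le (mul_nonneg hn'.le hr)
    have l0 : 0 ≤ Real.logb 2 ⌊(2 : ℝ) ^ ((n : ℝ) * r)⌋₊ := Real.logb_nonneg (by norm_num) (by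
      exact_mod_cast Nat.floor_pos.2 (Real.one_le_rpow (by norm_num) (mul_nonneg hn'.le hr)))
    have l3 : errorProb ch c * Real.logb 2 ⌊(2 : ℝ) ^ ((n : ℝ) * r)⌋₊ ≤ ε * (n * r) :=
      mul_le_mul hc.le l2 l0 hε0.le
    have l4 : ε * (n * r) ≤ n * (η / 2) := by
      rw [← hεR]
      have : ε * r ≤ ε * (R.1 + R.2 + 1) := mul_le_mul_of_nonneg_left (by linarith) hε0.le
      nlinarith
    linarith
  have hpos : ∀ r : ℝ, 0 ≤ r → 0 < ⌊(2 : ℝ) ^ ((n : ℝ) * r)⌋₊ := fun r hr =>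
    Nat.floor_pos.2 (Real.one_le_rpow (by norm_num) (mul_nonneg hn'.le hr))
  exact mem_convexHull_outerRegion_of_code ch c hn (hpos _ h1) (hpos _ h2)
    (key _ h1 (by linarith)) (key _ h2 (by linarith))

end Converse

end BroadcastChannel

end

theorem mainTheorem2 {X S Y Z : Type*} [Fintype X] [Fintype S] [Fintype Y] [Fintype Z]
    (ch : BroadcastChannel.Channel X S Y Z) :
    BroadcastChannel.capacityRegion ch ⊆
      closure (convexHull ℝ (BroadcastChannel.outerRegion ch)) := by
  refine closure_minimal (fun R hR => ?_) isClosed_closure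
  have hlim : Filter.Tendsto (fun η : ℝ => R - (η, η)) (nhdsWithin 0 (Set.Ioi 0)) (nhds R) := by
    have : Continuous fun η : ℝ => R - (η, η) := by fun_prop
    have h := (this.tendsto 0).mono_left (nhdsWithin_le_nhds (s := Set.Ioi 0))
    rwa [show R - ((0 : ℝ), (0 : ℝ)) = R from sub_zero R] at h
  refine mem_closure_of_tendsto hlim ?_
  filter_upwards [self_mem_nhdsWithin] with η hη
  exact BroadcastChannel.Achievable.sub_mem_convexHull hR hη
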